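/- Let $k$ be an algebraically closed field of characteristic $p$ (possibly $p=0$), and let $G_1,\dots,G_d$ be finite groups of orders $k_1,\dots,k_d$. Suppose that there is an integer $r$ with $1\le r\le d$ such that $|G_i|$ is invertible in $k$ for $1\le i\le r$ and $|G_i|=0$ in $k$ for $r<i\le d$. Let $n=\sum_{i=1}^d k_i$, and let $\mathcal{J}_{G_1,\dots,G_d}(k)\subseteq M_n(k)$ be the $k$-subalgebra of all block matrices $$\begin{bmatrix} C_1 & a_{12}J_{k_1,k_2} & \cdots & a_{1d}J_{k_1,k_d}\\ a_{21}J_{k_2,k_1} & C_2 & \cdots & a_{2d}J_{k_2,k_d}\\ \vdots & \vdots & \ddots & \vdots\\ a_{d1}J_{k_d,k_1} & a_{d2}J_{k_d,k_2} & \cdots & C_d\end{bmatrix},$$ where $a_{ij}\in k$, $J_{s,t}$ is the $s\times t$ matrix all of whose entries are $1$, and each $C_i$ is $G_i$-circulant, that is, with rows and columns indexed by $G_i$, $(C_i)_{gx,gy}=(C_i)_{x,y}$ for all $g,x,y\in G_i$. Then the number of isomorphism classes of irreducible (simple left) modules over $\mathcal{J}_{G_1,\dots,G_d}(k)$ is finite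 and equals $$\sum_{i=1}^d c_p(G_i)-r+1,$$ where $c_p(G_i)$ is the number of $p$-regular conjugacy classes of $G_i$, i.e. conjugacy classes of elements whose order is not divisible by $p$ (all conjugacy classes if $p=0$). -/

import Mathlib

universe u v w

/-- A matrix with rows and columns indexed by the elements of a group `G` is `G`-circulant if
`M (g * x) (g * y) = M x y` for all `g x y`. -/
def IsGCirculant {R : Type u} {G : Type v} [Group G] (M : Matrix G G R) : Prop :=
  ∀ g x y : G, M (g * x) (g * y) = M x y

/-- A block matrix, with blocks indexed by `Fin d` and the `(i, j)` block of shape `G i × G j`, is a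
join of `G i`-circulant matrices if each diagonal block is `G i`-circulant and each off-diagonal
block has all of its entries equal. -/
def IsJoin {R : Type u} {d : ℕ} {G : Fin d → Type v} [∀ i, Group (G i)]
    (A : Matrix (Σ i, G i) (Σ i, G i) R) : Prop :=
  (∀ i, IsGCirculant (A.submatrix (Sigma.mk i) (Sigma.mk i))) ∧
    ∀ i j, i ≠ j → ∃ a : R, A.submatrix (Sigma.mk i) (Sigma.mk j) = Matrix.of fun _ _ => a

/-- Joins are the matrices that are invariant under simultaneous left translations. -/
theorem isJoin_iff {R : Type u} {d : ℕ} {G : Fin d → Type v} [∀ i, Group (G i)]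
    (A : Matrix (Σ i, G i) (Σ i, G i) R) :
    IsJoin A ↔ ∀ (h : ∀ i, G i) (i j : Fin d) (x : G i) (y : G j),
      A ⟨i, h i * x⟩ ⟨j, h j * y⟩ = A ⟨i, x⟩ ⟨j, y⟩ := by
  constructor
  · rintro ⟨h1, h2⟩ h i j x y
    by_cases hij : i = j
    · subst hij
      exact h1 i (h i) x y
    · obtain ⟨a, ha⟩ := h2 i j hij
      have h3 : ∀ x y, A ⟨i, x⟩ ⟨j, y⟩ = a := fun x y => congrFun (congrFun ha x) y
      rw [h3, h3]
  · intro H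
    refine ⟨fun i g x y => ?_, fun i j hij => ⟨A ⟨i, 1⟩ ⟨j, 1⟩, ?_⟩⟩
    · simpa using H (Pi.mulSingle i g) i i x y
    · ext x y
      have := H (Function.update (Pi.mulSingle i x) j y) i j 1 1
      simpa [Function.update_of_ne hij] using this

/-- The join of the group rings `R[G 0], …, R[G (d - 1)]`: the subalgebra of the algebra of square
matrices of size `∑ i, |G i|` that consists of all joins of `G i`-circulant matrices. -/
def joinAlgebra (R : Type u) [CommRing R] {d : ℕ} (G : Fin d → Type v) [∀ i, Group (G i)]
    [∀ i, Fintype (G i)] [∀ i, DecidableEq (G i)] :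
    Subalgebra R (Matrix (Σ i, G i) (Σ i, G i) R) where
  carrier := {A | IsJoin A}
  mul_mem' := by
    intro A B hA hB
    rw [Set.mem_ofPred_eq, isJoin_iff] at *
    intro h i j x y
    rw [Matrix.mul_apply, Matrix.mul_apply]
    refine (Fintype.sum_equiv (Equiv.sigmaCongrRight fun l => Equiv.mulLeft (h l)) _ _ ?_).symm
    rintro ⟨l, z⟩
    simp [Equiv.sigmaCongrRight, hA h, hB h]
  add_mem' := by
    intro A B hA hB
    rw [Set.mem_ofPred_eq, isJoin_iff] at *
    intro h i j x y
    simp [hA h, hB h]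
  algebraMap_mem' := by
    intro r
    rw [Set.mem_ofPred_eq, isJoin_iff]
    intro h i j x y
    rw [Matrix.algebraMap_matrix_apply, Matrix.algebraMap_matrix_apply]
    by_cases hij : i = j
    · subst hij
      simp
    · simp [hij]

/-- Isomorphism of simple left modules over a ring `A`. -/
def simpleModuleSetoid (A : Type w) [Ring A] :
    Setoid {M : ModuleCat.{w} A // IsSimpleModule A M} where
  r M N := Nonempty (M.1 ≃ₗ[A] N.1)
  iseqv := ⟨fun M => ⟨LinearEquiv.refl A M.1⟩, fun ⟨e⟩ => ⟨e.symm⟩,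
    fun ⟨e⟩ ⟨f⟩ => ⟨e.trans f⟩⟩

/-- The isomorphism classes of simple (that is, irreducible) left `A`-modules. Every simple
`A`-module is a quotient of `A`, so modules in the universe of `A` suffice. -/
def SimpleModuleClasses (A : Type w) [Ring A] : Type (w + 1) :=
  Quotient (simpleModuleSetoid A)

/-- The number of `p`-regular conjugacy classes of `G`: the classes of elements whose order is not
divisible by `p`. For a finite group and `p = 0` these are all the conjugacy classes. -/
noncomputable def numPRegularClasses (p : ℕ) (G : Type v) [Group G] : ℕ :=
  Nat.card {c : ConjClasses G // ∀ g ∈ c.carrier, ¬ p ∣ orderOf g}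

/-! Over an algebraically closed field, a finite-dimensional algebra modulo its radical is a product
of matrix algebras, one per simple module. The traces of the factors form a basis of the trace forms
that kill nilpotents, so it suffices to compute the dimension of that space
(`card_simpleModuleClasses`).

On the join, a trace form kills the off-diagonal blocks and is given by a class function `F` on the
disjoint union of the groups. Swapping the factors of `J_ij J_ji` adds the condition `|G_j| ∑_{G_i}
F = |G_i| ∑_{G_j} F`. In characteristic `p`, vanishing on nilpotents means `F (g ^ q) = F g` for a
suitable power `q` of `p`: necessity holds because `g ^ q - g` is nilpotent, sufficiency because
`q`-th powers are additive modulo commutators. In characteristic `0` the join is semisimple and `q =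
1` serves. Such `F` are the functions on the `p`-regular classes.

If `|G_i| = 0` in `k`, then `J_ii` squares to zero and `∑_{G_i} F` vanishes by itself. The remaining
condition is that the means of `F` over the `r` groups of invertible order agree: `r - 1`
independent equations. -/

/-! ### Powers of sums under a trace form in prime characteristic -/

/-- A function on words that is invariant under rotation sums to the same value over all words of
length `p ^ m` as over the constant words. -/
theorem sum_vector_eq_sum_replicate {k ι : Type*} [Ring k] (p m : ℕ) [Fact p.Prime] [CharP k p]
    [Fintype ι] [DecidableEq ι] [DecidableEq k] (F : List ι → k)
    (hF : ∀ l, F (l.rotate 1) = F l) :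
    ∑ v : List.Vector ι (p ^ m), F v.1 = ∑ i, F (List.replicate (p ^ m) i) := by
  have hpos : 0 < p ^ m := pow_pos (Fact.out : p.Prime).pos m
  -- Rotation acts on each fibre of `F` with `p ^ m`-th power the identity. Hence a fibre has,
  -- modulo `p`, as many elements as it has fixed points, which are the constant words.
  have key : ∀ c : k, (Fintype.card {v : List.Vector ι (p ^ m) // F v.1 = c} : k) =
      Fintype.card {i : ι // F (List.replicate (p ^ m) i) = c} := by
    intro c
    let σ : Function.End {v : List.Vector ι (p ^ m) // F v.1 = c} := fun v =>
      ⟨⟨v.1.1.rotate 1, by rw [List.length_rotate]; exact v.1.2⟩, by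
        change F (v.1.1.rotate 1) = c
        rw [hF]; exact v.2⟩
    have hiter : ∀ (n : ℕ) (v), ((σ ^ n) v).1.1 = v.1.1.rotate n := by
      intro n
      induction n with
      | zero => intro v; exact (List.rotate_zero _).symm
      | succ n ih =>
        intro v
        rw [pow_succ']
        change ((σ ^ n) v).1.1.rotate 1 = _
        rw [ih, List.rotate_rotate]
    have hσ : σ ^ p ^ m = 1 := by
      funext v
      apply Subtype.ext
      apply Subtype.ext
      rw [hiter]
      have := v.1.1.rotate_length
      rwa [v.1.2] at this
    have h2 := Equiv.Perm.card_fixedPoints_modEq (p := p) hσ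
    rw [(CharP.natCast_eq_natCast k p).2 h2]
    congr 1
    symm
    refine Fintype.card_congr (Equiv.ofBijective (fun i =>
      ⟨⟨⟨List.replicate (p ^ m) i.1, List.length_replicate⟩, i.2⟩, ?_⟩) ⟨?_, ?_⟩)
    · apply Subtype.ext
      apply Subtype.ext
      change (List.replicate (p ^ m) i.1).rotate 1 = _
      rw [List.rotate_replicate]
    · intro i j hij
      have h3 : List.replicate (p ^ m) i.1 = List.replicate (p ^ m) j.1 :=
        congrArg (fun x => x.1.1.1) hij
      exact Subtype.ext ((List.replicate_right_inj hpos.ne').1 h3)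
    · rintro ⟨v, hv⟩
      have h3 : v.1.1.rotate 1 = v.1.1 := congrArg (fun x => x.1.1) hv
      have : Nonempty ι := ⟨v.1.1.head (by
        intro h
        have := v.1.2
        rw [h] at this
        simp at this
        omega)⟩
      obtain ⟨a, ha⟩ := List.rotate_one_eq_self_iff_eq_replicate.1 h3
      rw [v.1.2] at ha
      refine ⟨⟨a, ?_⟩, ?_⟩
      · rw [← ha]; exact v.2
      · apply Subtype.ext
        apply Subtype.ext
        apply Subtype.ext
        exact ha.symm
  classical
  have expand : ∀ {β : Type _} [Fintype β] (f : β → k), ∑ b, f b =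
      ∑ c ∈ (Finset.univ.image f), (Fintype.card {b // f b = c} : k) * c := by
    intro β _ f
    rw [← Finset.sum_fiberwise_of_maps_to (g := f) (t := Finset.univ.image f)
      (fun b _ => Finset.mem_image_of_mem _ (Finset.mem_univ _))]
    refine Finset.sum_congr rfl fun c _ => ?_
    rw [Finset.sum_congr rfl (g := fun _ => c) (fun b hb => (Finset.mem_filter.1 hb).2),
      Finset.sum_const, nsmul_eq_mul, Fintype.card_subtype]
  rw [expand (fun v : List.Vector ι (p ^ m) => F v.1), expand]
  have hsub : Finset.univ.image (fun i => F (List.replicate (p ^ m) i)) ⊆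
      Finset.univ.image (fun v : List.Vector ι (p ^ m) => F v.1) := by
    intro c hc
    obtain ⟨i, -, rfl⟩ := Finset.mem_image.1 hc
    exact Finset.mem_image.2 ⟨⟨List.replicate (p ^ m) i, List.length_replicate⟩,
      Finset.mem_univ _, rfl⟩
  rw [Finset.sum_subset hsub]
  · exact Finset.sum_congr rfl fun c _ => by rw [key]
  · intro c _ hc
    have : IsEmpty {i : ι // F (List.replicate (p ^ m) i) = c} :=
      ⟨fun i => hc (Finset.mem_image.2 ⟨i.1, Finset.mem_univ _, i.2⟩)⟩
    rw [Fintype.card_of_isEmpty, Nat.cast_zero, zero_mul]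

/-- Modulo commutators, raising to the power `p ^ m` is additive in characteristic `p`. -/
theorem trace_form_sum_pow {k A ι : Type*} [CommRing k] [Ring A] [Algebra k A] (p m : ℕ)
    [Fact p.Prime] [CharP k p] [Fintype ι] (f : A →ₗ[k] k) (hf : ∀ a b, f (a * b) = f (b * a))
    (x : ι → A) : f ((∑ i, x i) ^ p ^ m) = ∑ i, f (x i ^ p ^ m) := by
  classical
  have h1 : (∑ i, x i) ^ p ^ m = ∑ r : Fin (p ^ m) → ι, (List.ofFn fun j => x (r j)).prod := by
    have := MultilinearMap.map_sum (MultilinearMap.mkPiAlgebraFin k (p ^ m) A)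
      (fun (_ : Fin (p ^ m)) i => x i)
    simpa using this
  rw [h1, map_sum, ← Equiv.sum_comp (Equiv.vectorEquivFin ι (p ^ m))]
  -- Rotating a word permutes its product cyclically, which `f` does not detect.
  have h2 := sum_vector_eq_sum_replicate p m (fun l : List ι => f (l.map x).prod) (by
    intro l
    cases l with
    | nil => rfl
    | cons a l => simp [hf])
  simp only [List.map_replicate, List.prod_replicate] at h2
  rw [← h2]
  refine Finset.sum_congr rfl fun v _ => ?_
  congr 2
  apply List.ext_getElem
  · simp [v.2]
  · intro i h3 h4
    simp [Equiv.vectorEquivFin, List.Vector.get_eq_get_toList]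
    rfl

/-! ### Simple modules over finite-dimensional algebras -/

/-- The trace forms on a `k`-algebra that vanish on the nilpotent elements. -/
def nilTraceForms (k : Type u) (A : Type w) [Field k] [Ring A] [Algebra k A] :
    Submodule k (A →ₗ[k] k) where
  carrier := {f | (∀ a b, f (a * b) = f (b * a)) ∧ ∀ a, IsNilpotent a → f a = 0}
  add_mem' := by
    rintro f g ⟨hf, hf'⟩ ⟨hg, hg'⟩
    exact ⟨fun a b => by simp [hf a b, hg a b], fun a ha => by simp [hf' a ha, hg' a ha]⟩
  zero_mem' := ⟨fun _ _ => rfl, fun _ _ => rfl⟩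
  smul_mem' := by
    rintro c f ⟨hf, hf'⟩
    exact ⟨fun a b => by simp [hf a b], fun a ha => by simp [hf' a ha]⟩

theorem exists_surjective_pi_matrix (k : Type u) (A : Type w) [Field k] [IsAlgClosed k] [Ring A]
    [Algebra k A] [Module.Finite k A] :
    ∃ (n : ℕ) (d : Fin n → ℕ) (φ : A →ₐ[k] Π i, Matrix (Fin (d i)) (Fin (d i)) k),
      (∀ i, NeZero (d i)) ∧ Function.Surjective φ ∧ ∀ a, φ a = 0 ↔ a ∈ Ring.jacobson A := by
  have := IsArtinianRing.of_finite k A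
  obtain ⟨n, d, hd, ⟨e⟩⟩ :=
    IsSemisimpleRing.exists_algEquiv_pi_matrix_of_isAlgClosed k (A ⧸ Ring.jacobson A)
  refine ⟨n, d, e.toAlgHom.comp (Ideal.Quotient.mkₐ k _), hd,
    e.surjective.comp (Ideal.Quotient.mkₐ_surjective k _), fun a => ?_⟩
  change e (Ideal.Quotient.mk _ a) = 0 ↔ _
  rw [EmbeddingLike.map_eq_zero_iff, Ideal.Quotient.eq_zero_iff_mem]

theorem isNilpotent_of_mem_jacobson {A : Type w} [Ring A] [IsArtinianRing A] {a : A}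
    (ha : a ∈ Ring.jacobson A) : IsNilpotent a := by
  obtain ⟨n, hn⟩ := IsSemiprimaryRing.isNilpotent (R := A)
  exact ⟨n, by simpa [hn] using Ideal.pow_mem_pow ha n⟩

/-! ### Surjections onto products of matrix algebras -/

section PiMatrix

variable {k : Type u} {A : Type w} [Field k] [Ring A] [Algebra k A] {n : ℕ} {d : Fin n → ℕ}
  (φ : A →ₐ[k] Π i, Matrix (Fin (d i)) (Fin (d i)) k)

/-- A trace form on an algebra that factors through a surjection onto a product of matrix algebras
is a linear combination of the traces of the factors. -/
theorem exists_eq_sum_trace [∀ i, NeZero (d i)] (hφ : Function.Surjective φ) (f : A →ₗ[k] k)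
    (hf : ∀ a b, f (a * b) = f (b * a)) (hker : ∀ a, φ a = 0 → f a = 0) :
    ∃ c : Fin n → k, ∀ a, f a = ∑ i, c i * (φ a i).trace := by
  -- The section `s` is only linear; `f ∘ s` is still a trace form because `f` kills the kernel of
  -- `φ`.
  obtain ⟨s, hs⟩ := φ.toLinearMap.exists_rightInverse_of_surjective (LinearMap.range_eq_top.2 hφ)
  replace hs : ∀ x, φ (s x) = x := fun x => LinearMap.congr_fun hs x
  have hfs : ∀ a, f a = f (s (φ a)) := fun a => by
    rw [← sub_eq_zero, ← map_sub]
    exact hker _ (by rw [map_sub, hs, sub_self])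
  have hg : ∀ x y, f (s (x * y)) = f (s (y * x)) := fun x y => by
    have h1 := hfs (s x * s y)
    have h2 := hfs (s y * s x)
    rw [map_mul φ, hs, hs] at h1 h2
    rw [← h1, ← h2, hf]
  have hmul : ∀ i (x y : Matrix (Fin (d i)) (Fin (d i)) k),
      f (s (Pi.single i (x * y))) = f (s (Pi.single i (y * x))) := fun i x y => by
    rw [Pi.single_mul, hg, ← Pi.single_mul]
  have hdiag : ∀ i (j : Fin (d i)) (c : k), f (s (Pi.single i (Matrix.single j j c))) =
      f (s (Pi.single i (Matrix.single 0 0 1))) * c := fun i j c => by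
    have := hmul i (Matrix.single j 0 c) (Matrix.single 0 j 1)
    rw [Matrix.single_mul_single_same, Matrix.single_mul_single_same, mul_one, one_mul] at this
    rw [this, mul_comm, ← smul_eq_mul c, ← map_smul, ← map_smul, ← Pi.single_smul,
      Matrix.smul_single, smul_eq_mul, mul_one]
  have hoff : ∀ i (j l : Fin (d i)) (c : k), j ≠ l →
      f (s (Pi.single i (Matrix.single j l c))) = 0 := fun i j l c hjl => by
    have := hmul i (Matrix.single j j 1) (Matrix.single j l c)
    rwa [Matrix.single_mul_single_same, one_mul, Matrix.single_mul_single_of_ne _ _ _ _ hjl.symm,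
      Pi.single_zero, map_zero, map_zero] at this
  refine ⟨fun i => f (s (Pi.single i (Matrix.single 0 0 1))), fun a => ?_⟩
  rw [hfs, ← Finset.univ_sum_single (φ a), map_sum, map_sum, Finset.univ_sum_single]
  refine Finset.sum_congr rfl fun i _ => ?_
  have h3 : ∀ M : Matrix (Fin (d i)) (Fin (d i)) k, f (s (Pi.single i M)) =
      ∑ j, ∑ l, f (s (Pi.single i (Matrix.single j l (M j l)))) := fun M => by
    let g : Matrix (Fin (d i)) (Fin (d i)) k →ₗ[k] k :=
      f ∘ₗ s ∘ₗ LinearMap.single k (fun i => Matrix (Fin (d i)) (Fin (d i)) k) i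
    change g M = ∑ j, ∑ l, g _
    conv_lhs => rw [Matrix.matrix_eq_sum_single M]
    simp_rw [map_sum]
  rw [h3, Matrix.trace, Finset.mul_sum]
  refine Finset.sum_congr rfl fun j _ => ?_
  rw [Finset.sum_eq_single j (fun l _ hl => hoff i j l _ hl.symm) (by simp), hdiag]
  rfl

theorem trace_eq_zero_of_isNilpotent {a : A} (ha : IsNilpotent a) (i : Fin n) :
    (φ a i).trace = 0 := by
  refine (Matrix.isNilpotent_trace_of_isNilpotent ?_).eq_zero
  exact (ha.map φ).map (Pi.evalRingHom _ i)

/-- The traces of the factors are a basis: lifts of the units `E_00` of the factors separate them,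
and `exists_eq_sum_trace` shows that they span. -/
theorem finrank_nilTraceForms [∀ i, NeZero (d i)] (hφ : Function.Surjective φ)
    (hker : ∀ a, φ a = 0 → IsNilpotent a) : Module.finrank k (nilTraceForms k A) = n := by
  let Ψ : (Fin n → k) →ₗ[k] (A →ₗ[k] k) :=
    { toFun := fun c => ∑ i, c i • (Matrix.traceLinearMap _ k k ∘ₗ LinearMap.proj i ∘ₗ
        φ.toLinearMap)
      map_add' := fun c c' => by simp [add_smul, Finset.sum_add_distrib]
      map_smul' := fun t c => by simp [mul_smul, Finset.smul_sum] }
  have hΨ : ∀ c a, Ψ c a = ∑ i, c i * (φ a i).trace := fun c a => by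
    simp [Ψ, LinearMap.sum_apply]
  have hinj : Function.Injective Ψ := by
    rw [← LinearMap.ker_eq_bot, LinearMap.ker_eq_bot']
    intro c hc
    funext i
    obtain ⟨a, ha⟩ := hφ (Pi.single i (Matrix.single 0 0 1))
    have h := hΨ c a
    rw [hc, ha, Finset.sum_eq_single i] at h
    · simpa using h.symm
    · intro j _ hj
      simp [Pi.single_eq_of_ne hj]
    · simp
  have hrange : LinearMap.range Ψ = nilTraceForms k A := by
    ext f
    constructor
    · rintro ⟨c, rfl⟩
      refine ⟨fun a b => ?_, fun a ha => ?_⟩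
      · rw [hΨ, hΨ]
        refine Finset.sum_congr rfl fun i _ => ?_
        rw [map_mul, map_mul, Pi.mul_apply, Pi.mul_apply, Matrix.trace_mul_comm]
      · rw [hΨ]
        exact Finset.sum_eq_zero fun i _ => by
          rw [trace_eq_zero_of_isNilpotent φ ha, mul_zero]
    · rintro ⟨hf, hf'⟩
      obtain ⟨c, hc⟩ := exists_eq_sum_trace φ hφ f hf fun a ha => hf' a (hker a ha)
      exact ⟨c, LinearMap.ext fun a => by rw [hΨ, hc]⟩
  rw [← hrange, LinearMap.finrank_range_of_inj hinj, Module.finrank_fin_fun]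

/-- The left ideal of elements that act as zero on the first basis vector of the `i`-th factor. -/
def columnIdeal [∀ i, NeZero (d i)] (i : Fin n) : Ideal A where
  carrier := {a | ∀ j, φ a i j 0 = 0}
  add_mem' := fun {a b} ha hb j => by simp [ha j, hb j]
  zero_mem' := fun j => by simp
  smul_mem' := fun b a ha j => by
    simp [Matrix.mul_apply, show ∀ l, φ a i l 0 = 0 from ha]

variable {φ}

theorem mem_columnIdeal [∀ i, NeZero (d i)] {i : Fin n} {a : A} :
    a ∈ columnIdeal φ i ↔ ∀ j, φ a i j 0 = 0 := Iff.rfl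

theorem columnIdeal_isMaximal [∀ i, NeZero (d i)] (hφ : Function.Surjective φ) (i : Fin n) :
    (columnIdeal φ i).IsMaximal := by
  rw [Ideal.isMaximal_iff]
  refine ⟨fun h => by simpa using h 0, fun J a hJ ha haJ => ?_⟩
  rw [mem_columnIdeal] at ha
  push Not at ha
  obtain ⟨j, hj⟩ := ha
  -- This `b` is chosen so that `b * a` and `1` have the same first column in the `i`-th factor.
  obtain ⟨b, hb⟩ := hφ (Pi.single i (Matrix.single 0 j (φ a i j 0)⁻¹))
  have h1 : 1 - b * a ∈ columnIdeal φ i := fun l => by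
    rw [map_sub, map_mul, hb, map_one, Pi.sub_apply, Pi.mul_apply, Pi.single_eq_same,
      Matrix.sub_apply, Pi.one_apply]
    by_cases hl : l = 0
    · subst hl
      simp [hj]
    · rw [Matrix.single_mul_apply_of_ne _ _ _ _ _ hl, Matrix.one_apply_ne hl, sub_zero]
  simpa using J.add_mem (hJ h1) (J.mul_mem_left b haJ)

/-- A lift of the `i`-th central idempotent fixes the class of `1` in the first quotient and
annihilates the second. -/
theorem not_nonempty_columnIdeal_equiv [∀ i, NeZero (d i)] (hφ : Function.Surjective φ)
    {i j : Fin n} (hij : i ≠ j) :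
    ¬ Nonempty ((A ⧸ columnIdeal φ i) ≃ₗ[A] (A ⧸ columnIdeal φ j)) := by
  rintro ⟨E⟩
  obtain ⟨e, he⟩ := hφ (Pi.single i 1)
  have h1 : e • (Submodule.Quotient.mk 1 : A ⧸ columnIdeal φ i) = Submodule.Quotient.mk 1 := by
    rw [← Submodule.Quotient.mk_smul, Submodule.Quotient.eq]
    intro l
    simp [he]
  have h2 : ∀ x : A ⧸ columnIdeal φ j, e • x = 0 := by
    intro x
    obtain ⟨a, rfl⟩ := Submodule.Quotient.mk_surjective _ x
    rw [← Submodule.Quotient.mk_smul, Submodule.Quotient.mk_eq_zero]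
    intro l
    simp [he, Pi.single_eq_of_ne hij.symm]
  have h3 := congrArg E h1
  rw [map_smul, h2, eq_comm, EmbeddingLike.map_eq_zero_iff, Submodule.Quotient.mk_eq_zero] at h3
  simpa using h3 0

/-- The radical kills `M`, so some diagonal matrix unit `E_jj` acts nontrivially on some `m`. Then
`E_0j m` is nonzero and annihilated by the column ideal, and Schur's lemma applies. -/
theorem exists_columnIdeal_equiv [∀ i, NeZero (d i)] (hφ : Function.Surjective φ)
    (hker : ∀ a, φ a = 0 → a ∈ Ring.jacobson A) (M : Type*) [AddCommGroup M] [Module A M]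
    [IsSimpleModule A M] : ∃ i, Nonempty ((A ⧸ columnIdeal φ i) ≃ₗ[A] M) := by
  have hzero : ∀ a, φ a = 0 → ∀ m : M, a • m = 0 := fun a ha =>
    Module.mem_annihilator.1 (IsSemisimpleModule.jacobson_le_annihilator A M (hker a ha))
  have := IsSimpleModule.nontrivial A M
  obtain ⟨m, hm⟩ := exists_ne (0 : M)
  choose s hs using hφ
  have h1 : ∃ i j, s (Pi.single i (Matrix.single j j 1)) • m ≠ 0 := by
    by_contra! h
    apply hm
    have h2 := hzero (1 - ∑ i, ∑ j, s (Pi.single i (Matrix.single j j 1))) (by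
      simp_rw [map_sub, map_one, map_sum, hs]
      rw [sub_eq_zero]
      funext i
      rw [Finset.sum_apply, Finset.sum_eq_single i]
      · simp only [Finset.sum_apply, Pi.single_eq_same, Pi.one_apply]
        ext a b
        simp [Matrix.sum_apply, Matrix.one_apply, Matrix.single_apply, ite_and]
      · intro j _ hj
        simp [Finset.sum_apply, Pi.single_eq_of_ne hj.symm]
      · simp) m
    rw [sub_smul, one_smul, Finset.sum_smul] at h2
    simpa [Finset.sum_smul, h] using h2
  obtain ⟨i, j, hu⟩ := h1
  let m' := s (Pi.single i (Matrix.single 0 j 1)) • m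
  have hm' : m' ≠ 0 := by
    intro h
    apply hu
    have h2 := hzero (s (Pi.single i (Matrix.single j j 1)) -
      s (Pi.single i (Matrix.single j 0 1)) * s (Pi.single i (Matrix.single 0 j 1))) (by
        rw [map_sub, map_mul, hs, hs, hs, ← Pi.single_mul, Matrix.single_mul_single_same, mul_one,
          sub_self]) m
    rwa [sub_smul, mul_smul, show s (Pi.single i (Matrix.single 0 j 1)) • m = 0 from h, smul_zero,
      sub_zero] at h2
  have hle : columnIdeal φ i ≤ LinearMap.ker (LinearMap.toSpanSingleton A M m') := by
    intro a ha
    rw [LinearMap.mem_ker, LinearMap.toSpanSingleton_apply, ← mul_smul]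
    apply hzero
    rw [map_mul, hs]
    funext l
    by_cases hl : l = i
    · subst hl
      rw [Pi.mul_apply, Pi.single_eq_same]
      ext x y
      by_cases hy : y = j
      · subst hy
        simp [show φ a l x 0 = 0 from ha x]
      · rw [Matrix.mul_single_apply_of_ne _ _ _ _ _ hy]
        rfl
    · simp [Pi.single_eq_of_ne hl]
  have : IsSimpleModule A (A ⧸ columnIdeal φ i) :=
    isSimpleModule_iff_isCoatom.2 (columnIdeal_isMaximal (fun x => ⟨s x, hs x⟩) i).out
  refine ⟨i, ⟨LinearEquiv.ofBijective ((columnIdeal φ i).liftQ _ hle) ?_⟩⟩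
  refine (LinearMap.bijective_or_eq_zero _).resolve_right fun h => hm' ?_
  have := LinearMap.congr_fun h (Submodule.Quotient.mk 1)
  simpa using this

end PiMatrix

/-- The simple modules of a finite-dimensional algebra over an algebraically closed field are
counted by the trace forms that vanish on nilpotent elements. -/
theorem card_simpleModuleClasses (k : Type u) (A : Type w) [Field k] [IsAlgClosed k] [Ring A]
    [Algebra k A] [Module.Finite k A] :
    Finite (SimpleModuleClasses A) ∧
      Nat.card (SimpleModuleClasses A) = Module.finrank k (nilTraceForms k A) := by
  have := IsArtinianRing.of_finite k A
  obtain ⟨n, d, φ, hd, hφ, hker⟩ := exists_surjective_pi_matrix k A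
  rw [finrank_nilTraceForms φ hφ fun a ha => isNilpotent_of_mem_jacobson ((hker a).1 ha)]
  have hsimple : ∀ i, IsSimpleModule A (A ⧸ columnIdeal φ i) := fun i =>
    isSimpleModule_iff_isCoatom.2 (columnIdeal_isMaximal hφ i).out
  let Φ : Fin n → SimpleModuleClasses A := fun i =>
    Quotient.mk (simpleModuleSetoid A) ⟨ModuleCat.of A (A ⧸ columnIdeal φ i), hsimple i⟩
  have hΦ : Function.Bijective Φ := by
    constructor
    · intro i j hij
      by_contra hne
      exact not_nonempty_columnIdeal_equiv hφ hne (Quotient.exact hij)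
    · intro c
      induction c using Quotient.inductionOn with
      | h M =>
        have := M.2
        obtain ⟨i, hi⟩ := exists_columnIdeal_equiv hφ (fun a ha => (hker a).1 ha) M.1
        exact ⟨i, Quotient.sound hi⟩
  exact ⟨Finite.of_surjective Φ hΦ.2, by
    rw [← Nat.card_eq_of_bijective Φ hΦ, Nat.card_eq_fintype_card, Fintype.card_fin]⟩

/-! ### Trace forms on joins of group rings -/

section Join

variable {k : Type u} [Field k] {d : ℕ} {G : Fin d → Type v} [∀ i, Group (G i)]
  [∀ i, Fintype (G i)] [∀ i, DecidableEq (G i)]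

theorem joinAlgebra_apply_mul (a : joinAlgebra k G) (h : ∀ i, G i) (i j : Fin d) (x : G i)
    (y : G j) : a.1 ⟨i, h i * x⟩ ⟨j, h j * y⟩ = a.1 ⟨i, x⟩ ⟨j, y⟩ :=
  (isJoin_iff a.1).1 a.2 h i j x y

theorem joinAlgebra_apply_diag (a : joinAlgebra k G) (i : Fin d) (x y : G i) :
    a.1 ⟨i, x⟩ ⟨i, y⟩ = a.1 ⟨i, 1⟩ ⟨i, x⁻¹ * y⟩ := by
  have := joinAlgebra_apply_mul a (Pi.mulSingle i x) i i 1 (x⁻¹ * y)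
  simpa using this

theorem joinAlgebra_apply_offDiag (a : joinAlgebra k G) {i j : Fin d} (hij : i ≠ j) (x : G i)
    (y : G j) : a.1 ⟨i, x⟩ ⟨j, y⟩ = a.1 ⟨i, 1⟩ ⟨j, 1⟩ := by
  obtain ⟨c, hc⟩ := a.2.2 i j hij
  have h : ∀ x y, a.1 ⟨i, x⟩ ⟨j, y⟩ = c := fun x y => congrFun (congrFun hc x) y
  rw [h, h]

theorem joinAlgebra_ext {a b : joinAlgebra k G}
    (hdiag : ∀ i (g : G i), a.1 ⟨i, 1⟩ ⟨i, g⟩ = b.1 ⟨i, 1⟩ ⟨i, g⟩)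
    (hoff : ∀ i j, i ≠ j → a.1 ⟨i, 1⟩ ⟨j, 1⟩ = b.1 ⟨i, 1⟩ ⟨j, 1⟩) : a = b := by
  apply Subtype.ext
  ext ⟨i, x⟩ ⟨j, y⟩
  by_cases hij : i = j
  · subst hij
    rw [joinAlgebra_apply_diag a, joinAlgebra_apply_diag b, hdiag]
  · rw [joinAlgebra_apply_offDiag a hij, joinAlgebra_apply_offDiag b hij, hoff i j hij]

/-- The element of the join algebra that corresponds to `s.2` in the group ring of `G s.1`. -/
def blockElem (k : Type u) [Field k] (s : Σ i, G i) : joinAlgebra k G :=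
  ⟨Matrix.of fun x y =>
      if x.1 = s.1 ∧ y = ⟨x.1, x.2 * Pi.mulSingle s.1 s.2 x.1⟩ then 1 else 0, by
    change IsJoin _
    rw [isJoin_iff]
    intro h i j x y
    have : (⟨j, h j * y⟩ : Σ i, G i) = ⟨i, h i * x * (Pi.mulSingle s.1 s.2 : ∀ i, G i) i⟩ ↔
        (⟨j, y⟩ : Σ i, G i) = ⟨i, x * (Pi.mulSingle s.1 s.2 : ∀ i, G i) i⟩ := by
      by_cases hij : j = i
      · subst hij
        simp [mul_assoc]
      · simp [hij]
    exact if_congr (and_congr Iff.rfl this) rfl rfl⟩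

/-- The element of the join algebra with ones in the `(i, j)` block and zeros elsewhere. -/
def blockOnes (k : Type u) [Field k] (i j : Fin d) : joinAlgebra k G :=
  ⟨Matrix.of fun x y => if x.1 = i ∧ y.1 = j then 1 else 0, by
    change IsJoin _
    rw [isJoin_iff]
    intro h i j x y
    rfl⟩

/-! ### Multiplication table of the spanning family -/

theorem blockElem_apply (s x y : Σ i, G i) : (blockElem k s).1 x y =
    if x.1 = s.1 ∧ y = ⟨x.1, x.2 * Pi.mulSingle s.1 s.2 x.1⟩ then 1 else 0 := rfl

theorem blockOnes_apply (i j : Fin d) (x y : Σ i, G i) : (blockOnes k i j).1 x y =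
    if x.1 = i ∧ y.1 = j then 1 else 0 := rfl

theorem joinAlgebra_mul_apply (a b : joinAlgebra k G) (x y : Σ i, G i) :
    (a * b).1 x y = ∑ z, a.1 x z * b.1 z y :=
  Matrix.mul_apply

theorem joinAlgebra_smul_apply (c : k) (a : joinAlgebra k G) (x y : Σ i, G i) :
    (c • a).1 x y = c * a.1 x y := rfl

theorem blockElem_mul_apply (s : Σ i, G i) (a : joinAlgebra k G) (x y : Σ i, G i) :
    (blockElem k s * a).1 x y =
      if x.1 = s.1 then a.1 ⟨x.1, x.2 * Pi.mulSingle s.1 s.2 x.1⟩ y else 0 := by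
  rw [joinAlgebra_mul_apply]
  simp only [blockElem_apply]
  by_cases h : x.1 = s.1 <;> simp [h]

theorem blockElem_mul_blockElem (i : Fin d) (g h : G i) :
    blockElem k (⟨i, g⟩ : Σ i, G i) * blockElem k ⟨i, h⟩ = blockElem k ⟨i, g * h⟩ := by
  apply Subtype.ext
  ext ⟨j, x⟩ y
  rw [blockElem_mul_apply, blockElem_apply, blockElem_apply]
  by_cases hj : j = i
  · subst hj
    simp [mul_assoc]
  · simp [hj]

/-- Exponent zero is excluded because `blockElem k ⟨i, 1⟩` is the idempotent of the `i`-th block, in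
general not `1`. -/
theorem blockElem_pow (i : Fin d) (g : G i) {n : ℕ} (hn : n ≠ 0) :
    blockElem k (⟨i, g⟩ : Σ i, G i) ^ n = blockElem k ⟨i, g ^ n⟩ := by
  induction n with
  | zero => exact absurd rfl hn
  | succ n ih =>
    rcases Nat.eq_zero_or_pos n with rfl | hpos
    · simp
    · rw [pow_succ, ih hpos.ne', blockElem_mul_blockElem, ← pow_succ]

theorem blockElem_one_mul_blockOnes (i j : Fin d) :
    blockElem k (⟨i, 1⟩ : Σ i, G i) * blockOnes k i j = blockOnes k i j := by
  apply Subtype.ext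
  ext ⟨l, x⟩ y
  rw [blockElem_mul_apply, blockOnes_apply, blockOnes_apply]
  by_cases hl : l = i <;> simp [hl]

theorem blockOnes_mul_blockElem {i j : Fin d} (hij : i ≠ j) (g : G i) :
    blockOnes k i j * blockElem k (⟨i, g⟩ : Σ i, G i) = 0 := by
  apply Subtype.ext
  ext x y
  rw [joinAlgebra_mul_apply]
  refine Finset.sum_eq_zero fun z _ => ?_
  rw [blockOnes_apply, blockElem_apply]
  by_cases hz : z.1 = j
  · simp [hz, hij.symm]
  · simp [hz]

theorem blockOnes_mul_blockOnes (i j l : Fin d) :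
    (blockOnes k i j * blockOnes k j l : joinAlgebra k G) =
      (Fintype.card (G j) : k) • blockOnes k i l := by
  apply Subtype.ext
  ext x y
  rw [joinAlgebra_mul_apply, joinAlgebra_smul_apply, Fintype.sum_sigma, Finset.sum_eq_single j]
  · by_cases hx : x.1 = i <;> simp [blockOnes_apply, hx]
  · intro b _ hb
    simp [blockOnes_apply, hb]
  · simp

theorem blockOnes_mul_self {i j : Fin d} (hij : i ≠ j) :
    (blockOnes k i j * blockOnes k i j : joinAlgebra k G) = 0 := by
  apply Subtype.ext
  ext x y
  rw [joinAlgebra_mul_apply]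
  refine Finset.sum_eq_zero fun z _ => ?_
  by_cases hz : z.1 = j
  · simp [blockOnes_apply, hz, hij.symm]
  · simp [blockOnes_apply, hz]

theorem blockOnes_pow {i j : Fin d} (hij : i ≠ j) {n : ℕ} (hn : 2 ≤ n) :
    (blockOnes k i j : joinAlgebra k G) ^ n = 0 :=
  pow_eq_zero_of_le hn (by rw [pow_two, blockOnes_mul_self hij])

theorem joinAlgebra_sum_apply {ι : Type*} (s : Finset ι) (f : ι → joinAlgebra k G)
    (x y : Σ i, G i) :
    (∑ i ∈ s, f i).1 x y = ∑ i ∈ s, (f i).1 x y := by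
  rw [← Matrix.sum_apply]
  exact congrFun (congrFun (map_sum (joinAlgebra k G).val f s) x) y

/-- The components of an element of the join algebra with respect to the spanning family that
consists of the group elements and the off-diagonal blocks of ones. -/
def joinComponent (a : joinAlgebra k G) : (Σ i, G i) ⊕ (Fin d × Fin d) → joinAlgebra k G
  | .inl s => a.1 ⟨s.1, 1⟩ s • blockElem k s
  -- The diagonal gets coefficient zero, since `J_ii` is already a sum of group elements.
  | .inr t => (if t.1 = t.2 then 0 else a.1 ⟨t.1, 1⟩ ⟨t.2, 1⟩) • blockOnes k t.1 t.2

theorem joinComponent_inl (a : joinAlgebra k G) (s : Σ i, G i) :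
    joinComponent a (.inl s) = a.1 ⟨s.1, 1⟩ s • blockElem k s := rfl

theorem joinComponent_inr (a : joinAlgebra k G) (t : Fin d × Fin d) :
    joinComponent a (.inr t) =
      (if t.1 = t.2 then 0 else a.1 ⟨t.1, 1⟩ ⟨t.2, 1⟩ : k) • blockOnes k t.1 t.2 := rfl

theorem joinAlgebra_eq_sum (a : joinAlgebra k G) : a = ∑ s, joinComponent a s := by
  rw [Fintype.sum_sum_type]
  simp only [joinComponent_inl, joinComponent_inr]
  apply joinAlgebra_ext
  · intro i g
    change _ = (∑ s : Σ i, G i, _ : joinAlgebra k G).1 _ _ +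
      (∑ t : Fin d × Fin d, _ : joinAlgebra k G).1 _ _
    rw [joinAlgebra_sum_apply, joinAlgebra_sum_apply, Finset.sum_eq_single ⟨i, g⟩,
      Finset.sum_eq_zero, add_zero]
    · simp [joinAlgebra_smul_apply, blockElem_apply]
    · rintro ⟨j, l⟩ _
      rw [joinAlgebra_smul_apply, blockOnes_apply]
      by_cases hjl : j = l
      · simp [hjl]
      · have : ¬ (i = j ∧ i = l) := fun h => hjl (h.1.symm.trans h.2)
        simp [this]
    · rintro ⟨j, x⟩ _ hne
      rw [joinAlgebra_smul_apply, blockElem_apply, if_neg, mul_zero]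
      rintro ⟨hj, h⟩
      have hj' : i = j := hj
      subst hj'
      apply hne
      simpa using h.symm
    · simp
  · intro i j hij
    change _ = (∑ s : Σ i, G i, _ : joinAlgebra k G).1 _ _ +
      (∑ t : Fin d × Fin d, _ : joinAlgebra k G).1 _ _
    rw [joinAlgebra_sum_apply, joinAlgebra_sum_apply, Finset.sum_eq_zero,
      Finset.sum_eq_single ⟨i, j⟩, zero_add]
    · simp [joinAlgebra_smul_apply, blockOnes_apply, hij]
    · rintro ⟨l, l'⟩ _ hne
      have : ¬ (i = l ∧ j = l') := fun h => hne (Prod.ext h.1.symm h.2.symm)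
      rw [joinAlgebra_smul_apply, blockOnes_apply]
      dsimp only
      rw [if_neg this, mul_zero]
    · simp
    · rintro ⟨l, x⟩ _
      rw [joinAlgebra_smul_apply, blockElem_apply, if_neg, mul_zero]
      rintro ⟨-, h⟩
      exact hij (congrArg Sigma.fst h).symm

theorem blockOnes_self (i : Fin d) :
    (blockOnes k i i : joinAlgebra k G) = ∑ g : G i, blockElem k ⟨i, g⟩ := by
  apply Subtype.ext
  ext ⟨j, x⟩ ⟨l, y⟩
  rw [joinAlgebra_sum_apply, blockOnes_apply]
  by_cases hj : j = i
  · subst hj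
    by_cases hl : l = j
    · subst hl
      rw [Finset.sum_eq_single (x⁻¹ * y)]
      · simp [blockElem_apply]
      · intro g _ hg
        rw [blockElem_apply, if_neg]
        rintro ⟨-, h⟩
        apply hg
        have h' : y = x * g := by simpa using h
        rw [h', inv_mul_cancel_left]
      · simp
    · simp [blockElem_apply, hl]
  · simp [blockElem_apply, hj]

/-- The linear form on the join algebra that takes the value `F s` at the group element `s` and
vanishes on the off-diagonal blocks. -/
def diagForm (k : Type u) [Field k] (G : Fin d → Type v) [∀ i, Group (G i)] [∀ i, Fintype (G i)]
    [∀ i, DecidableEq (G i)] : ((Σ i, G i) → k) →ₗ[k] (joinAlgebra k G →ₗ[k] k) :=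
  LinearMap.mk₂ k (fun F a => ∑ s, F s * a.1 ⟨s.1, 1⟩ s)
    (fun F F' a => by simp [add_mul, Finset.sum_add_distrib])
    (fun c F a => by simp [mul_assoc, Finset.mul_sum])
    (fun F a b => by simp [mul_add, Finset.sum_add_distrib])
    (fun c F a => by simp [mul_left_comm, Finset.mul_sum])

theorem diagForm_apply (F : (Σ i, G i) → k) (a : joinAlgebra k G) :
    diagForm k G F a = ∑ s, F s * a.1 ⟨s.1, 1⟩ s := rfl

theorem diagForm_blockElem (F : (Σ i, G i) → k) (s : Σ i, G i) :
    diagForm k G F (blockElem k s) = F s := by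
  obtain ⟨i, g⟩ := s
  rw [diagForm_apply, Finset.sum_eq_single ⟨i, g⟩]
  · simp [blockElem_apply]
  · rintro ⟨j, x⟩ _ hne
    rw [blockElem_apply, if_neg, mul_zero]
    rintro ⟨hj, h⟩
    have hj' : j = i := hj
    subst hj'
    apply hne
    simpa using h
  · simp

theorem diagForm_blockOnes_self (F : (Σ i, G i) → k) (i : Fin d) :
    diagForm k G F (blockOnes k i i) = ∑ g, F ⟨i, g⟩ := by
  rw [blockOnes_self, map_sum]
  exact Finset.sum_congr rfl fun g _ => diagForm_blockElem F _

theorem diagForm_injective : Function.Injective (diagForm k G) := fun F F' h => by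
  funext s
  rw [← diagForm_blockElem F, h, diagForm_blockElem]

theorem diagForm_blockOnes (F : (Σ i, G i) → k) {i j : Fin d} (hij : i ≠ j) :
    diagForm k G F (blockOnes k i j) = 0 := by
  rw [diagForm_apply]
  refine Finset.sum_eq_zero fun s _ => ?_
  rw [blockOnes_apply, if_neg, mul_zero]
  rintro ⟨h1, h2⟩
  exact hij (h1.symm.trans h2)

/-! ### Trace forms as class functions -/

theorem trace_form_blockOnes {f : joinAlgebra k G →ₗ[k] k} (hf : ∀ a b, f (a * b) = f (b * a))
    {i j : Fin d} (hij : i ≠ j) : f (blockOnes k i j) = 0 := by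
  -- With `e_i` the idempotent of the `i`-th block, `e_i J_ij = J_ij` but `J_ij e_i = 0`.
  rw [← blockElem_one_mul_blockOnes, hf, blockOnes_mul_blockElem hij, map_zero]

theorem eq_diagForm {f : joinAlgebra k G →ₗ[k] k} (hf : ∀ a b, f (a * b) = f (b * a)) :
    f = diagForm k G fun s => f (blockElem k s) := by
  ext a
  rw [joinAlgebra_eq_sum a, map_sum, map_sum]
  refine Finset.sum_congr rfl fun s _ => ?_
  rcases s with s | ⟨i, j⟩
  · simp only [joinComponent_inl, map_smul, diagForm_blockElem]
  · simp only [joinComponent_inr, map_smul]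
    by_cases hij : i = j
    · simp [hij]
    · rw [trace_form_blockOnes hf hij, diagForm_blockOnes _ hij]

/-- The functions on the disjoint union of the `G i` that define trace forms on the join. -/
def IsTraceFunction (F : (Σ i, G i) → k) : Prop :=
  (∀ i (x y : G i), F ⟨i, x * y⟩ = F ⟨i, y * x⟩) ∧
    ∀ i j, i ≠ j → (Fintype.card (G j) : k) * ∑ g, F ⟨i, g⟩ = Fintype.card (G i) * ∑ g, F ⟨j, g⟩

theorem isTraceFunction_of_trace_form {f : joinAlgebra k G →ₗ[k] k}
    (hf : ∀ a b, f (a * b) = f (b * a)) :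
    IsTraceFunction fun s : Σ i, G i => f (blockElem k s) := by
  refine ⟨fun i x y => ?_, fun i j _ => ?_⟩
  · change f _ = f _
    rw [← blockElem_mul_blockElem, hf, blockElem_mul_blockElem]
  · have := hf (blockOnes k i j) (blockOnes k j i)
    rwa [blockOnes_mul_blockOnes, blockOnes_mul_blockOnes, map_smul, map_smul, blockOnes_self,
      blockOnes_self, map_sum, map_sum] at this

theorem diagForm_mul_comm {F : (Σ i, G i) → k} (hF : IsTraceFunction F) (a b : joinAlgebra k G) :
    diagForm k G F (a * b) = diagForm k G F (b * a) := by
  have expand : ∀ a b : joinAlgebra k G, diagForm k G F (a * b) =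
      ∑ i, ∑ j, ∑ g : G i, ∑ z : G j, F ⟨i, g⟩ * (a.1 ⟨i, 1⟩ ⟨j, z⟩ * b.1 ⟨j, z⟩ ⟨i, g⟩) := by
    intro a b
    rw [diagForm_apply, Fintype.sum_sigma]
    refine Finset.sum_congr rfl fun i _ => ?_
    rw [Finset.sum_comm]
    refine Finset.sum_congr rfl fun g _ => ?_
    rw [joinAlgebra_mul_apply, Fintype.sum_sigma, Finset.mul_sum]
    exact Finset.sum_congr rfl fun j _ => Finset.mul_sum _ _ _
  rw [expand, expand, Finset.sum_comm]
  refine Finset.sum_congr rfl fun j _ => Finset.sum_congr rfl fun i _ => ?_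
  by_cases hij : i = j
  · subst hij
    have h1 : ∀ a b : joinAlgebra k G,
        (∑ g : G i, ∑ z : G i, F ⟨i, g⟩ * (a.1 ⟨i, 1⟩ ⟨i, z⟩ * b.1 ⟨i, z⟩ ⟨i, g⟩)) =
        ∑ z : G i, ∑ w : G i, F ⟨i, z * w⟩ * (a.1 ⟨i, 1⟩ ⟨i, z⟩ * b.1 ⟨i, 1⟩ ⟨i, w⟩) := by
      intro a b
      rw [Finset.sum_comm]
      refine Finset.sum_congr rfl fun z _ => ?_
      rw [← Equiv.sum_comp (Equiv.mulLeft z)]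
      refine Finset.sum_congr rfl fun w _ => ?_
      simp [joinAlgebra_apply_diag b i z]
    rw [h1, h1, Finset.sum_comm]
    refine Finset.sum_congr rfl fun w _ => Finset.sum_congr rfl fun z _ => ?_
    rw [hF.1 i z w, mul_comm (a.1 _ _)]
  · have h1 : ∀ (a b : joinAlgebra k G) (i j : Fin d), i ≠ j →
        (∑ g : G i, ∑ z : G j, F ⟨i, g⟩ * (a.1 ⟨i, 1⟩ ⟨j, z⟩ * b.1 ⟨j, z⟩ ⟨i, g⟩)) =
        (Fintype.card (G j) * ∑ g, F ⟨i, g⟩) * (a.1 ⟨i, 1⟩ ⟨j, 1⟩ * b.1 ⟨j, 1⟩ ⟨i, 1⟩) := by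
      intro a b i j hij
      simp_rw [joinAlgebra_apply_offDiag a hij, joinAlgebra_apply_offDiag b (Ne.symm hij)]
      simp [Finset.mul_sum, Finset.sum_mul, mul_assoc]
    rw [h1 a b i j hij, h1 b a j i (Ne.symm hij), hF.2 i j hij, mul_comm (a.1 _ _)]

/-! ### Vanishing on nilpotent elements -/

theorem diagForm_pow (p m : ℕ) [Fact p.Prime] [CharP k p] (hm : m ≠ 0) {F : (Σ i, G i) → k}
    (hF : IsTraceFunction F) (hq : ∀ i (g : G i), F ⟨i, g ^ p ^ m⟩ = F ⟨i, g⟩)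
    (a : joinAlgebra k G) : diagForm k G F a ^ p ^ m =
      diagForm k G (fun s => F s ^ p ^ m) (a ^ p ^ m) := by
  have hp : p.Prime := Fact.out
  have hF' : IsTraceFunction fun s : Σ i, G i => F s ^ p ^ m := by
    refine ⟨fun i x y => congrArg (· ^ p ^ m) (hF.1 i x y), fun i j hij => ?_⟩
    have := congrArg (iterateFrobenius k p m) (hF.2 i j hij)
    simpa [map_mul, map_sum, iterateFrobenius_def] using this
  -- Additivity reduces the claim to the spanning family: group elements go to their `p ^ m`-th
  -- powers, where `F` is unchanged, and off-diagonal blocks square to zero.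
  have h1 := trace_form_sum_pow p m (diagForm k G fun s => F s ^ p ^ m)
    (diagForm_mul_comm hF') (joinComponent a)
  rw [← joinAlgebra_eq_sum a, Fintype.sum_sum_type] at h1
  rw [h1, diagForm_apply, sum_pow_char_pow,
    Finset.sum_eq_zero (s := (Finset.univ : Finset (Fin d × Fin d))), add_zero]
  · refine Finset.sum_congr rfl fun s _ => ?_
    rw [joinComponent_inl, smul_pow, map_smul, blockElem_pow _ _ (pow_pos hp.pos m).ne',
      diagForm_blockElem, hq, mul_pow, smul_eq_mul, mul_comm]
  · rintro ⟨i, j⟩ _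
    rw [joinComponent_inr]
    by_cases hij : i = j
    · simp [hij, hp.ne_zero]
    · rw [smul_pow, blockOnes_pow hij (hp.two_le.trans (Nat.le_self_pow hm p)), smul_zero, map_zero]

theorem diagForm_eq_zero_of_isNilpotent (p m : ℕ) [Fact p.Prime] [CharP k p] (hm : m ≠ 0)
    {F : (Σ i, G i) → k} (hF : IsTraceFunction F)
    (hq : ∀ i (g : G i), F ⟨i, g ^ p ^ m⟩ = F ⟨i, g⟩) {a : joinAlgebra k G}
    (ha : IsNilpotent a) : diagForm k G F a = 0 := by
  obtain ⟨n, hn⟩ := ha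
  have hp : p.Prime := Fact.out
  have hq' : ∀ N i (g : G i), F ⟨i, g ^ p ^ (m * N)⟩ = F ⟨i, g⟩ := by
    intro N
    induction N with
    | zero => simp
    | succ N ih =>
      intro i g
      rw [mul_add, mul_one, pow_add, pow_mul, hq, ih]
  -- The invariance of `F` is iterated until the exponent exceeds the nilpotency index `n`.
  have h1 := diagForm_pow p (m * (n + 1)) (mul_ne_zero hm n.succ_ne_zero) hF (hq' (n + 1)) a
  have hle : n ≤ p ^ (m * (n + 1)) :=
    (Nat.lt_pow_self hp.one_lt).le.trans (Nat.pow_le_pow_right hp.pos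
      (n.le_succ.trans (Nat.le_mul_of_pos_left _ (Nat.pos_of_ne_zero hm))))
  rw [pow_eq_zero_of_le hle hn, map_zero] at h1
  exact eq_zero_of_pow_eq_zero h1

/-- In the join of the single group `H`, the all-ones matrix squares to `|H|` times itself, that is,
to zero; the form given by `F` takes the value `∑ g, F g` there. -/
theorem sum_eq_zero_of_card_eq_zero (p m : ℕ) [Fact p.Prime] [CharP k p] (hm : m ≠ 0)
    {H : Type v} [Group H] [Fintype H] (hcard : (Fintype.card H : k) = 0) (F : H → k)
    (hF : ∀ x y, F (x * y) = F (y * x)) (hq : ∀ g, F (g ^ p ^ m) = F g) : ∑ g, F g = 0 := by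
  classical
  rw [← diagForm_blockOnes_self (G := fun _ : Fin 1 => H) (fun s => F s.2) 0]
  refine diagForm_eq_zero_of_isNilpotent p m hm
    ⟨fun _ => hF, fun i j hij => absurd (Subsingleton.elim i j) hij⟩ (fun _ => hq) ⟨2, ?_⟩
  rw [pow_two, blockOnes_mul_blockOnes, hcard, zero_smul]

theorem trace_form_pow_eq (p m : ℕ) [Fact p.Prime] [CharP k p]
    {f : joinAlgebra k G →ₗ[k] k} (hf : f ∈ nilTraceForms k (joinAlgebra k G))
    (hq : ∀ i (g : G i), (g ^ p ^ m) ^ p ^ m = g ^ p ^ m) (i : Fin d) (g : G i) :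
    f (blockElem k ⟨i, g ^ p ^ m⟩) = f (blockElem k ⟨i, g⟩) := by
  have hpos : p ^ m ≠ 0 := (pow_pos (Fact.out : p.Prime).pos m).ne'
  rw [← sub_eq_zero, ← map_sub]
  -- The elements `g ^ p ^ m` and `g` commute and have the same `p ^ m`-th power, so their
  -- difference is nilpotent.
  refine hf.2 _ ⟨p ^ m, ?_⟩
  have : Nonempty (Σ i, G i) := ⟨⟨i, g⟩⟩
  have : CharP (joinAlgebra k G) p :=
    charP_of_injective_algebraMap (FaithfulSMul.algebraMap_injective k (joinAlgebra k G)) p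
  have : ExpChar (joinAlgebra k G) p := ExpChar.prime Fact.out
  rw [sub_pow_expChar_pow_of_commute, blockElem_pow _ _ hpos, blockElem_pow _ _ hpos, hq, sub_self]
  rw [Commute, SemiconjBy, blockElem_mul_blockElem, blockElem_mul_blockElem, ← pow_succ,
    ← pow_succ']

/-- The matrix trace is nondegenerate here: pairing with `g⁻¹` gives `|G_i|` times the coefficient
of `g`, and pairing with `J_ji` gives `|G_i| |G_j| a_ij`. -/
theorem joinAlgebra_eq_zero_of_trace (hcard : ∀ i, (Fintype.card (G i) : k) ≠ 0)
    {a : joinAlgebra k G} (ha : ∀ b : joinAlgebra k G, (b * a).1.trace = 0) : a = 0 := by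
  apply joinAlgebra_ext
  · intro i g
    have h := ha (blockElem k ⟨i, g⁻¹⟩)
    rw [Matrix.trace, Fintype.sum_sigma, Finset.sum_eq_single i] at h
    · simp_rw [Matrix.diag_apply, blockElem_mul_apply] at h
      simpa [joinAlgebra_apply_diag a i _, hcard] using h
    · intro j _ hj
      refine Finset.sum_eq_zero fun x _ => ?_
      rw [Matrix.diag_apply, blockElem_mul_apply, if_neg hj]
    · simp
  · intro i j hij
    have h := ha (blockOnes k j i)
    rw [Matrix.trace, Fintype.sum_sigma, Finset.sum_eq_single j] at h
    · simp_rw [Matrix.diag_apply, joinAlgebra_mul_apply] at h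
      rw [Finset.sum_congr rfl (g := fun _ => (Fintype.card (G i) : k) * a.1 ⟨i, 1⟩ ⟨j, 1⟩)] at h
      · simpa [hcard] using h
      · intro x _
        rw [Fintype.sum_sigma, Finset.sum_eq_single i]
        · simp [blockOnes_apply, joinAlgebra_apply_offDiag a hij]
        · intro l _ hl
          simp [blockOnes_apply, hl]
        · simp
    · intro l _ hl
      refine Finset.sum_eq_zero fun x _ => ?_
      rw [Matrix.diag_apply, joinAlgebra_mul_apply]
      exact Finset.sum_eq_zero fun z _ => by simp [blockOnes_apply, hl]
    · simp

/-- Multiples of radical elements are nilpotent, hence of trace zero, so nondegeneracy makes the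
radical trivial and every trace form a combination of traces of the factors. -/
theorem diagForm_eq_zero_of_isNilpotent_of_card_ne_zero [IsAlgClosed k]
    (hcard : ∀ i, (Fintype.card (G i) : k) ≠ 0) {F : (Σ i, G i) → k} (hF : IsTraceFunction F)
    {a : joinAlgebra k G} (ha : IsNilpotent a) : diagForm k G F a = 0 := by
  have := IsArtinianRing.of_finite k (joinAlgebra k G)
  obtain ⟨n, d', φ, hd, hφ, hker⟩ := exists_surjective_pi_matrix k (joinAlgebra k G)
  have hzero : ∀ a, φ a = 0 → a = 0 := fun a h => joinAlgebra_eq_zero_of_trace hcard fun b =>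
    (Matrix.isNilpotent_trace_of_isNilpotent ((isNilpotent_of_mem_jacobson
      (Ideal.mul_mem_left _ b ((hker a).1 h))).map (joinAlgebra k G).val)).eq_zero
  obtain ⟨c, hc⟩ := exists_eq_sum_trace φ hφ _ (diagForm_mul_comm hF) fun a h => by
    rw [hzero a h, map_zero]
  rw [hc]
  exact Finset.sum_eq_zero fun i _ => by rw [trace_eq_zero_of_isNilpotent φ ha, mul_zero]

end Join

/-! ### Functions on `p`-regular classes and the dimension count -/

section Regular

/-- A power of `p` to which every element of each `G i` has a `p`-regular power, and which fixes
the `p`-regular elements. -/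
theorem exists_pow_regular (p : ℕ) [hp : Fact p.Prime] {d : ℕ} (G : Fin d → Type v)
    [∀ i, Group (G i)] [∀ i, Fintype (G i)] :
    ∃ m ≠ 0, ∀ i (g : G i), ¬ p ∣ orderOf (g ^ p ^ m) ∧ (¬ p ∣ orderOf g → g ^ p ^ m = g) := by
  have hN : ∏ i, Fintype.card (G i) ≠ 0 := Finset.prod_ne_zero_iff.2 fun i _ =>
    Fintype.card_ne_zero
  obtain ⟨a, n, hn, hNa⟩ := Nat.exists_eq_pow_mul_and_not_dvd hN p hp.out.ne_one
  have hn0 : 0 < n := Nat.pos_of_ne_zero fun h => hn (h ▸ dvd_zero p)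
  have hφ : 0 < n.totient := Nat.totient_pos.2 hn0
  have hcop : Nat.Coprime p n := (Nat.Prime.coprime_iff_not_dvd hp.out).2 hn
  have hord : ∀ i (g : G i), orderOf g ∣ p ^ a * n := fun i g =>
    hNa ▸ (orderOf_dvd_card).trans (Finset.dvd_prod_of_mem _ (Finset.mem_univ i))
  -- The exponent is at least `a`, which removes the `p`-part of every order, and a multiple of
  -- `φ(n)`, so that `p ^ m ≡ 1` modulo `n`. Using `a + 1` keeps it nonzero.
  refine ⟨n.totient * (a + 1), (Nat.mul_pos hφ a.succ_pos).ne', fun i g => ⟨fun h => hn ?_,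
    fun h => ?_⟩⟩
  · refine h.trans (orderOf_dvd_of_pow_eq_one ?_)
    rw [← pow_mul, ← orderOf_dvd_iff_pow_eq_one]
    exact (hord i g).trans (Nat.mul_dvd_mul_right (pow_dvd_pow p
      (a.le_succ.trans (Nat.le_mul_of_pos_left _ hφ))) n)
  · have hdvd : orderOf g ∣ n := (Nat.Coprime.dvd_mul_left (Nat.Coprime.pow_right a
      ((Nat.Prime.coprime_iff_not_dvd hp.out).2 h).symm)).1 (hord i g)
    have h1 : p ^ (n.totient * (a + 1)) ≡ 1 [MOD n] := by
      rw [pow_mul]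
      simpa using (Nat.ModEq.pow_totient hcop).pow (a + 1)
    conv_rhs => rw [← pow_one g]
    exact pow_eq_pow_iff_modEq.2 (h1.of_dvd hdvd)

variable (k : Type u) [Field k] {d : ℕ} (G : Fin d → Type v) [∀ i, Group (G i)]

/-- The class functions on the disjoint union of the `G i` that are invariant under taking `q`-th
powers. -/
def powClassFunctions (q : ℕ) : Submodule k ((Σ i, G i) → k) where
  carrier := {F | (∀ i (x y : G i), F ⟨i, x * y⟩ = F ⟨i, y * x⟩) ∧
    ∀ i (g : G i), F ⟨i, g ^ q⟩ = F ⟨i, g⟩}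
  add_mem' := by
    rintro F F' ⟨h1, h2⟩ ⟨h1', h2'⟩
    exact ⟨fun i x y => by simp [h1 i x y, h1' i x y], fun i g => by simp [h2, h2']⟩
  zero_mem' := ⟨fun _ _ _ => rfl, fun _ _ => rfl⟩
  smul_mem' := by
    rintro c F ⟨h1, h2⟩
    exact ⟨fun i x y => by simp [h1 i x y], fun i g => by simp [h2]⟩

variable {G}

theorem mk_mul_pow_comm {H : Type*} [Group H] (x y : H) (q : ℕ) :
    ConjClasses.mk ((x * y) ^ q) = ConjClasses.mk ((y * x) ^ q) := by
  rw [ConjClasses.mk_eq_mk_iff_isConj, isConj_iff]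
  exact ⟨y, by rw [← conj_pow]; simp [mul_assoc]⟩

theorem not_dvd_orderOf_of_mem_mk {H : Type*} [Group H] {p : ℕ} {x : H} (hx : ¬ p ∣ orderOf x) :
    ∀ g ∈ (ConjClasses.mk x).carrier, ¬ p ∣ orderOf g := by
  intro g hg
  rw [ConjClasses.mem_carrier_iff_mk_eq, ConjClasses.mk_eq_mk_iff_isConj, isConj_iff] at hg
  obtain ⟨c, rfl⟩ := hg
  rwa [← MulAut.conj_apply, MulEquiv.orderOf_eq] at hx

variable [∀ i, Fintype (G i)]

/-- The map sending `g` to the class of `g ^ q` is onto the `p`-regular classes, and the functions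
in question are the pullbacks along it. -/
theorem finrank_powClassFunctions {p q : ℕ} (hq : ∀ i (g : G i), ¬ p ∣ orderOf (g ^ q))
    (hq' : ∀ i (g : G i), ¬ p ∣ orderOf g → g ^ q = g) :
    Module.finrank k (powClassFunctions k G q) = ∑ i, numPRegularClasses p (G i) := by
  classical
  let C : Fin d → Type v := fun i =>
    {c : ConjClasses (G i) // ∀ g ∈ c.carrier, ¬ p ∣ orderOf g}
  have : ∀ i, Fintype (C i) := fun i => Fintype.ofFinite _
  let ρ : (Σ i, G i) → Σ i, C i := fun s =>
    ⟨s.1, ConjClasses.mk (s.2 ^ q), not_dvd_orderOf_of_mem_mk (hq s.1 s.2)⟩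
  have hρ : Function.Surjective ρ := by
    rintro ⟨i, c, hc⟩
    obtain ⟨g, rfl⟩ := ConjClasses.exists_rep c
    refine ⟨⟨i, g⟩, ?_⟩
    have : g ^ q = g := hq' i g (hc g ConjClasses.mem_carrier_mk)
    simp [ρ, this]
  have hrange : LinearMap.range (LinearMap.funLeft k k ρ) = powClassFunctions k G q := by
    ext F
    constructor
    · rintro ⟨h, rfl⟩
      refine ⟨fun i x y => ?_, fun i g => ?_⟩
      · simp only [LinearMap.funLeft_apply, ρ, mk_mul_pow_comm x y]
      · simp only [LinearMap.funLeft_apply, ρ, hq' i _ (hq i g)]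
    · rintro ⟨h1, h2⟩
      have hF : F.FactorsThrough ρ := by
        rintro ⟨i, x⟩ ⟨j, y⟩ hxy
        obtain rfl : i = j := congrArg Sigma.fst hxy
        have h3 : ConjClasses.mk (x ^ q) = ConjClasses.mk (y ^ q) :=
          congrArg Subtype.val (eq_of_heq (Sigma.mk.inj hxy).2)
        obtain ⟨c, hc⟩ := isConj_iff.1 (ConjClasses.mk_eq_mk_iff_isConj.1 h3)
        rw [← h2 i x, ← h2 i y, ← hc, h1, inv_mul_cancel_left]
      obtain ⟨e, he⟩ := (Function.factorsThrough_iff F).1 hF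
      exact ⟨e, he.symm⟩
  rw [← hrange, LinearMap.finrank_range_of_inj (LinearMap.funLeft_injective_of_surjective k k ρ hρ),
    Module.finrank_fintype_fun_eq_card, Fintype.card_sigma]
  exact Finset.sum_congr rfl fun i _ => Nat.card_eq_fintype_card.symm

variable [∀ i, DecidableEq (G i)] [IsAlgClosed k]

/-- The trace forms on a join that vanish on the nilpotent elements are the forms `diagForm k G F`,
where `F` is a suitable function on the `p`-regular classes. -/
theorem exists_diagForm_mem_nilTraceForms_iff (p : ℕ) [CharP k p] :
    ∃ q : ℕ, (∀ i (g : G i), ¬ p ∣ orderOf (g ^ q)) ∧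
      (∀ i (g : G i), ¬ p ∣ orderOf g → g ^ q = g) ∧
      (∀ F ∈ powClassFunctions k G q, ∀ i, (Fintype.card (G i) : k) = 0 → ∑ g, F ⟨i, g⟩ = 0) ∧
      ∀ F, diagForm k G F ∈ nilTraceForms k (joinAlgebra k G) ↔
        F ∈ powClassFunctions k G q ∧ IsTraceFunction F := by
  have htrace : ∀ F, diagForm k G F ∈ nilTraceForms k (joinAlgebra k G) → IsTraceFunction F := by
    intro F h
    have := isTraceFunction_of_trace_form h.1
    simpa only [diagForm_blockElem] using this
  rcases CharP.char_is_prime_or_zero k p with hp | rfl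
  · have : Fact p.Prime := ⟨hp⟩
    obtain ⟨m, hm, h⟩ := exists_pow_regular p G
    refine ⟨p ^ m, fun i g => (h i g).1, fun i g => (h i g).2, fun F hF i hi =>
      sum_eq_zero_of_card_eq_zero p m hm hi (fun g => F ⟨i, g⟩) (hF.1 i) (hF.2 i),
      fun F => ⟨fun hF => ⟨⟨(htrace F hF).1, fun i g => ?_⟩, htrace F hF⟩, fun hF =>
        ⟨diagForm_mul_comm hF.2, fun a ha =>
          diagForm_eq_zero_of_isNilpotent p m hm hF.2 hF.1.2 ha⟩⟩⟩
    have := trace_form_pow_eq p m hF (fun i g => (h i _).2 (h i g).1) i g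
    rwa [diagForm_blockElem, diagForm_blockElem] at this
  · have : CharZero k := CharP.charP_to_charZero k
    have hcard : ∀ i, (Fintype.card (G i) : k) ≠ 0 := fun i =>
      Nat.cast_ne_zero.2 Fintype.card_ne_zero
    refine ⟨1, fun i g h => (orderOf_pos (g ^ 1)).ne' (Nat.eq_zero_of_zero_dvd h),
      fun i g _ => pow_one g, fun F _ i hi => absurd hi (hcard i),
      fun F => ⟨fun hF => ⟨⟨(htrace F hF).1, fun i g => by rw [pow_one]⟩, htrace F hF⟩,
        fun hF => ⟨diagForm_mul_comm hF.2, fun a ha =>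
          diagForm_eq_zero_of_isNilpotent_of_card_ne_zero hcard hF.2 ha⟩⟩⟩

/-- Here `r + 1` groups have invertible order, and `r` counts the equations that compare their means
with that of the group of index `0`. -/
theorem finrank_nilTraceForms_joinAlgebra (p : ℕ) [CharP k p] (r : ℕ) (hrd : r + 1 ≤ d)
    (hinv : ∀ i : Fin d, (i : ℕ) < r + 1 → (Fintype.card (G i) : k) ≠ 0)
    (hzero : ∀ i : Fin d, r + 1 ≤ (i : ℕ) → (Fintype.card (G i) : k) = 0) :
    Module.finrank k (nilTraceForms k (joinAlgebra k G)) + r = ∑ i, numPRegularClasses p (G i) := by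
  obtain ⟨q, hq, hq', hsum, hmem⟩ := exists_diagForm_mem_nilTraceForms_iff k (G := G) p
  let mean (i : Fin d) : ((Σ i, G i) → k) →ₗ[k] k :=
    (Fintype.card (G i) : k)⁻¹ • ∑ g, LinearMap.proj ⟨i, g⟩
  have hmean : ∀ i F, mean i F = (Fintype.card (G i) : k)⁻¹ * ∑ g, F ⟨i, g⟩ := fun i F => by
    simp [mean, LinearMap.sum_apply]
  let X := powClassFunctions k G q
  let T : X →ₗ[k] (Fin r → k) := LinearMap.pi fun j =>
    (mean ⟨j + 1, by omega⟩ - mean ⟨0, by omega⟩) ∘ₗ X.subtype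
  have hT : ∀ F : X, T F = 0 ↔ IsTraceFunction F.1 := by
    intro F
    have hT0 : T F = 0 ↔ ∀ j : Fin r, mean ⟨j + 1, by omega⟩ F.1 = mean ⟨0, by omega⟩ F.1 := by
      simp [T, funext_iff, sub_eq_zero]
    rw [hT0]
    constructor
    · intro h
      have hall : ∀ i : Fin d, (i : ℕ) < r + 1 → mean i F.1 = mean ⟨0, by omega⟩ F.1 := by
        rintro ⟨i, hi⟩ hir
        rcases i with _ | i
        · rfl
        · exact h ⟨i, by simpa using hir⟩
      refine ⟨F.2.1, fun i j _ => ?_⟩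
      by_cases hi : (i : ℕ) < r + 1
      · by_cases hj : (j : ℕ) < r + 1
        · have h1 := (hall i hi).trans (hall j hj).symm
          rw [hmean, hmean] at h1
          have := hinv i hi
          have := hinv j hj
          field_simp at h1
          linear_combination h1
        · rw [hsum F.1 F.2 j (hzero j (by omega)), hzero j (by omega), zero_mul, mul_zero]
      · rw [hsum F.1 F.2 i (hzero i (by omega)), hzero i (by omega), zero_mul, mul_zero]
    · intro h j
      rw [hmean, hmean]
      have h1 := h.2 ⟨j + 1, by omega⟩ ⟨0, by omega⟩ (by simp)
      have := hinv ⟨j + 1, by omega⟩ (by simp)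
      have := hinv ⟨0, by omega⟩ (by simp)
      field_simp
      linear_combination h1
  have hTsurj : Function.Surjective T := by
    intro c
    -- `F` is constant on each group, with value `c (i - 1)` for `1 ≤ i ≤ r` and zero otherwise.
    -- Index `0` is excluded explicitly because of truncated subtraction.
    let F : (Σ i, G i) → k := fun s =>
      if h : (s.1 : ℕ) - 1 < r ∧ (s.1 : ℕ) ≠ 0 then c ⟨s.1 - 1, h.1⟩ else 0
    refine ⟨⟨F, fun i x y => rfl, fun i g => rfl⟩, ?_⟩
    funext j
    change mean _ F - mean _ F = c j
    have := hinv ⟨j + 1, by omega⟩ (by simp)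
    simp [hmean, F, this]
  have hmap : nilTraceForms k (joinAlgebra k G) =
      (LinearMap.ker T).map (diagForm k G ∘ₗ X.subtype) := by
    ext f
    constructor
    · intro hf
      have h1 := eq_diagForm hf.1
      have h2 := (hmem _).1 (h1 ▸ hf)
      exact ⟨⟨_, h2.1⟩, (hT _).2 h2.2, h1.symm⟩
    · rintro ⟨F, hF, rfl⟩
      exact (hmem _).2 ⟨F.2, (hT F).1 hF⟩
  have hinj : Function.Injective (diagForm k G ∘ₗ X.subtype) :=
    diagForm_injective.comp X.subtype_injective
  have hrank := T.finrank_range_add_finrank_ker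
  rw [LinearMap.range_eq_top.2 hTsurj, finrank_top, Module.finrank_fin_fun,
    finrank_powClassFunctions k hq hq'] at hrank
  rw [hmap, ← (Submodule.equivMapOfInjective _ hinj (LinearMap.ker T)).finrank_eq, add_comm, hrank]

end Regular

theorem mainTheorem12 {k : Type u} [Field k] [IsAlgClosed k] (p : ℕ) [CharP k p]
    {d : ℕ} (G : Fin d → Type v) [∀ i, Group (G i)] [∀ i, Fintype (G i)]
    [∀ i, DecidableEq (G i)]
    (r : ℕ) (hr : 1 ≤ r) (hrd : r ≤ d)
    (hinv : ∀ i : Fin d, (i : ℕ) < r → IsUnit (Fintype.card (G i) : k))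
    (hzero : ∀ i : Fin d, r ≤ (i : ℕ) → (Fintype.card (G i) : k) = 0) :
    Finite (SimpleModuleClasses (joinAlgebra k G)) ∧
      (Nat.card (SimpleModuleClasses (joinAlgebra k G)) : ℤ) =
        ∑ i, (numPRegularClasses p (G i) : ℤ) - r + 1 := by
  obtain ⟨hfin, hcard⟩ := card_simpleModuleClasses k (joinAlgebra k G)
  refine ⟨hfin, ?_⟩
  obtain ⟨r, rfl⟩ := Nat.exists_eq_add_of_le' hr
  have h := finrank_nilTraceForms_joinAlgebra k p r hrd (fun i hi => (hinv i hi).ne_zero) hzero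
  rw [hcard, ← Nat.cast_sum, ← h]
  push_cast
  ring
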